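/- Let $d\in\mathbb N$, $0<T<\infty$, $M=(\mathbb R/\mathbb Z)^d$, equipped with an arbitrary smooth Riemannian metric $g=(g_{ij})$; indices are raised and lowered with $g$, repeated indices $i,j$ in upper and lower position are summed, $\nabla$ is the Levi-Civita connection of $g$, and everything is written in the standard global coordinates $x^1,\dots,x^d$. A *flow* on $M$ is a vector field $u(t,x)=u^i(t,x)\,\partial/\partial x^i$ that is smooth on $[0,T]\times M$; it is *incompressible* if $\mathrm{div}_g u=\nabla_i u^i=0$; it is an *Euler flow* if there is a smooth $p:[0,T]\times M\to\mathbb R$ with $$\partial_t u+\nabla_u u=-\mathrm{grad}_g\,p,\qquad \mathrm{div}_g u=0\qquad\text{on }[0,T]\times M,$$ and the same terms are used on any Riemannian torus. The flow $u$ is *extendible to an Euler flow* if there are $m\ge 0$, smooth positive functions $w_1,\dots,w_m$ on $M$ with $\prod_{s=1}^m w_s=1$, and smooth functions $c_1,\dots,c_m:[0,T]\times M\to\mathbb R$ such that $$\tilde u(t,(x,\theta))=u^i(t,x)\frac{\partial}{\partial x^i}+\sum_{s=1}^m c_s(t,x)\frac{\partial}{\partial\theta^s}$$ is an Euler flow on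 $M\times(\mathbb R/\mathbb Z)^m$ with the metric $g_{ij}(x)\,dx^i dx^j+\sum_{s=1}^m w_s(x)\,(d\theta^s)^2$. Let $u$ be an incompressible flow on $(M,g)$ with $\frac1{8T}<u^j(t,x)<\frac1{4T}$ for all $j=1,\dots,d$, $t\in[0,T]$, $x\in M$. Let $A:[0,T]\times M\to M$ be its labels (back-to-labels) map, i.e. the smooth solution of $$\partial_t A^i+u^j\partial_jA^i=0,\qquad A^i(0,x)=x^i .$$ Suppose that for each $i=1,\dots,d$ there is a function $F_i:M\times\mathbb R/\mathbb Z\to\mathbb R$ of the form $$F_i(a,y)=\sum_{s=1}^{m_i}f_{i,s}(a)\,h_{i,s}(y),\qquad f_{i,s}\in C^\infty(M),\ h_{i,s}\in C^\infty(\mathbb R/\mathbb Z),\ m_i\in\mathbb N,$$ and that there is a smooth $p:[0,T]\times M\to\mathbb R$ such that, for all $i$, $$\partial_t u_i(t,x)+u^j\nabla_ju_i(t,x)+F_i(A(t,x),x^i)=-\partial_i p(t,x)\qquad\text{on }[0,T]\times M.$$ Then $u$ is extendible to an Euler flow. -/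

import Mathlib

open scoped ContDiff

noncomputable section

namespace EulerExt

/-- The torus `(ℝ/ℤ)^ι`. -/
abbrev Torus (ι : Type) : Type := ι → UnitAddCircle

/-- The covering projection `ℝ^ι → (ℝ/ℤ)^ι`. -/
def proj {ι : Type} (y : ι → ℝ) : Torus ι := fun i => (y i : UnitAddCircle)

/-- `f ∈ C^∞((ℝ/ℤ)^ι)`: the `ℤ^ι`-periodic function on `ℝ^ι` given by `f` is smooth. -/
def Smooth {ι : Type} [Fintype ι] (f : Torus ι → ℝ) : Prop :=
  ContDiff ℝ ∞ fun y : ι → ℝ => f (proj y)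

/-- `h ∈ C^∞(ℝ/ℤ)`. -/
def CircleSmooth (h : UnitAddCircle → ℝ) : Prop :=
  ContDiff ℝ ∞ fun y : ℝ => h (y : UnitAddCircle)

/-- `f : [0,T] → C^∞((ℝ/ℤ)^ι)` is smooth, i.e. smooth in spacetime `[0,T] × (ℝ/ℤ)^ι` up to the
boundary times. Only the values at times in `[0,T]` matter. -/
def SpacetimeSmooth {ι : Type} [Fintype ι] (T : ℝ) (f : ℝ → Torus ι → ℝ) : Prop :=
  ContDiffOn ℝ ∞ (fun q : ℝ × (ι → ℝ) => f q.1 (proj q.2)) (Set.Icc 0 T ×ˢ Set.univ)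

/-- The partial derivative `∂_i f` in the standard global coordinates of the torus. -/
def pd {ι : Type} [DecidableEq ι] (i : ι) (f : Torus ι → ℝ) (x : Torus ι) : ℝ :=
  deriv (fun s : ℝ => f (x + proj (Pi.single i s))) 0

/-- The time derivative `∂_t f` on `[0,T]` (one-sided at the endpoints). -/
def dt {X : Type} (T : ℝ) (f : ℝ → X → ℝ) (t : ℝ) (x : X) : ℝ :=
  derivWithin (fun τ : ℝ => f τ x) (Set.Icc 0 T) t

/-- A smooth Riemannian metric on the torus, given by its components `g_{ij}` in the standard
global coordinates. -/
structure Metric (ι : Type) [Fintype ι] where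
  /-- the matrix `(g_{ij}(x))` -/
  comp : Torus ι → Matrix ι ι ℝ
  smooth : ∀ i j, Smooth fun x => comp x i j
  /-- symmetric and positive definite -/
  posDef : ∀ x, (comp x).PosDef

section Geometry

variable {ι : Type} [Fintype ι] [DecidableEq ι] (g : Metric ι)

/-- The Christoffel symbol `Γ^k_{ij}` of the Levi-Civita connection of `g`. -/
def christoffel (k i j : ι) (x : Torus ι) : ℝ :=
  (1 / 2 : ℝ) * ∑ l, (g.comp x)⁻¹ k l *
    (pd i (fun z => g.comp z j l) x + pd j (fun z => g.comp z i l) x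
      - pd l (fun z => g.comp z i j) x)

/-- `∇_j v^k` for a vector field `v`. -/
def covDerivVec (v : Torus ι → ι → ℝ) (j k : ι) (x : Torus ι) : ℝ :=
  pd j (fun z => v z k) x + ∑ i, christoffel g k j i x * v x i

/-- `∇_j α_k` for a one-form `α`. -/
def covDerivForm (α : Torus ι → ι → ℝ) (j k : ι) (x : Torus ι) : ℝ :=
  pd j (fun z => α z k) x - ∑ i, christoffel g i j k x * α x i

/-- Lowering the index of a vector field: `v_k = g_{jk} v^j`. -/
def lower (v : Torus ι → ι → ℝ) (x : Torus ι) (k : ι) : ℝ :=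
  ∑ j, g.comp x j k * v x j

/-- `(grad_g f)^k = g^{kl} ∂_l f`. -/
def grad (f : Torus ι → ℝ) (x : Torus ι) (k : ι) : ℝ :=
  ∑ l, (g.comp x)⁻¹ k l * pd l f x

/-- `div_g v = ∇_k v^k`. -/
def divergence (v : Torus ι → ι → ℝ) (x : Torus ι) : ℝ :=
  ∑ k, covDerivVec g v k k x

/-- A flow on `[0,T]`: a smooth time-dependent vector field, given by its components `u t x i`. -/
def IsFlow (T : ℝ) (u : ℝ → Torus ι → ι → ℝ) : Prop :=
  ∀ i, SpacetimeSmooth T fun t x => u t x i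

/-- An incompressible flow: `div_g u = 0` on `[0,T] × (ℝ/ℤ)^ι`. -/
def IsIncompressibleFlow (T : ℝ) (u : ℝ → Torus ι → ι → ℝ) : Prop :=
  IsFlow T u ∧ ∀ t ∈ Set.Icc 0 T, ∀ x, divergence g (u t) x = 0

/-- An Euler flow: a flow `u` for which there is a smooth pressure `p` such that
`∂_t u + ∇_u u = - grad_g p` and `div_g u = 0` on `[0,T] × (ℝ/ℤ)^ι`. -/
def IsEulerFlow (T : ℝ) (u : ℝ → Torus ι → ι → ℝ) : Prop :=
  IsFlow T u ∧ ∃ p : ℝ → Torus ι → ℝ, SpacetimeSmooth T p ∧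
    ∀ t ∈ Set.Icc 0 T, ∀ x,
      (∀ k, dt T (fun τ z => u τ z k) t x + ∑ j, u t x j * covDerivVec g (u t) j k x
        = - grad g (p t) x k) ∧
      divergence g (u t) x = 0

/-- The projection of `M × (ℝ/ℤ)^m`, for `M = (ℝ/ℤ)^ι`, to the base `M`. The product is
the torus with index type `ι ⊕ Fin m`. -/
def base {ι : Type} {m : ℕ} (z : Torus (ι ⊕ Fin m)) : Torus ι := fun i => z (Sum.inl i)

/-- The metric `g'` on `M × (ℝ/ℤ)^m` makes it an extension of `(M, g)`:
`dg'^2 = g_{ij}(x) dx^i dx^j + ∑ s, w_s(x) (dθ^s)^2` with `w_s` smooth on `M` and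
`∏ s, w_s = 1`. Positivity of the `w_s` is forced by `g'` being a Riemannian metric. -/
def IsExtensionMetric {m : ℕ} (g' : Metric (ι ⊕ Fin m)) : Prop :=
  ∃ w : Fin m → Torus ι → ℝ, (∀ s, Smooth (w s)) ∧ (∀ x, ∏ s, w s x = 1) ∧
    ∀ z, g'.comp z =
      Matrix.fromBlocks (g.comp (base z)) 0 0 (Matrix.diagonal fun s => w s (base z))

/-- The flow `u'` on `M × (ℝ/ℤ)^m` is an extension of the flow `u` on `M`:
`u'(t,(x,θ)) = u^i(t,x) ∂/∂x^i + ∑ s, c_s(t,x) ∂/∂θ^s` with smooth swirl coefficients `c_s`. -/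
def IsExtensionFlow {m : ℕ} (T : ℝ) (u : ℝ → Torus ι → ι → ℝ)
    (u' : ℝ → Torus (ι ⊕ Fin m) → (ι ⊕ Fin m) → ℝ) : Prop :=
  ∃ c : Fin m → ℝ → Torus ι → ℝ, (∀ s, SpacetimeSmooth T (c s)) ∧
    ∀ t ∈ Set.Icc 0 T, ∀ z,
      (∀ i, u' t z (Sum.inl i) = u t (base z) i) ∧ ∀ s, u' t z (Sum.inr s) = c s t (base z)

/-- `u` is extendible to an Euler flow. -/
def IsExtendible (T : ℝ) (u : ℝ → Torus ι → ι → ℝ) : Prop :=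
  ∃ (m : ℕ) (g' : Metric (ι ⊕ Fin m)) (u' : ℝ → Torus (ι ⊕ Fin m) → (ι ⊕ Fin m) → ℝ),
    IsExtensionMetric g g' ∧ IsExtensionFlow T u u' ∧ IsEulerFlow g' T u'

/-- `A : [0,T] × (ℝ/ℤ)^ι → (ℝ/ℤ)^ι` is the labels map of the flow `u`: the smooth solution of
`∂_t A^i + u^j ∂_j A^i = 0`, `A^i(0,x) = x^i`. As `A` takes values in the torus, the equation
is expressed through a smooth lift `B : [0,T] × ℝ^ι → ℝ^ι` of `A` to the universal covers;
the derivatives of the components of `A` are those of the lift. -/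
def IsLabelsMap (T : ℝ) (u : ℝ → Torus ι → ι → ℝ) (A : ℝ → Torus ι → Torus ι) : Prop :=
  (∃ B : ℝ → (ι → ℝ) → (ι → ℝ),
    ContDiffOn ℝ ∞ (fun q : ℝ × (ι → ℝ) => B q.1 q.2) (Set.Icc 0 T ×ˢ Set.univ) ∧
    ∀ t ∈ Set.Icc 0 T, ∀ y, proj (B t y) = A t (proj y) ∧
      ∀ i, dt T (fun τ z => B τ z i) t y
        + ∑ j, u t (proj y) j * deriv (fun s : ℝ => B t (y + Pi.single j s) i) 0 = 0) ∧
  ∀ x, A 0 x = x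

end Geometry

end EulerExt

end

noncomputable section

namespace EulerExt

/-! ### Calculus on the torus in periodic coordinates -/

section Calculus

variable {ι : Type}

/-! In the extended metric the `θ^s` equation says that the angular momentum `b_s = w_s c_s` is
transported by `u`, so `b_s` may be any function of the labels. Its effect on the base momentum
equation is the centrifugal term `(1/2) b_s² ∂_i(1/w_s)`. Taking `1/w_σ = v_σ + const` and `b_σ² =
2(φ_σ(A) + const)` therefore absorbs any force `∑ φ_σ(A) ∂_i v_σ(x)`: the constants secure
positivity and cost only a gradient, and one extra fibre without swirl restores `∏ w_s = 1`
(`isExtendible_of_transported`, `isExtendible_of_force`).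

It remains to write `f(A) h(x^i)` in this form. If `h` has mean zero, then `h = H'` on the circle
and `v = H(x^i)` works; the obstruction is the mean of `h`. The velocity bound keeps `x^i - A^i` in
`[0, 1/4]` modulo 1 (`IsLabelsMap.exists_displacement`), so a constant is needed only on a strip
around the diagonal. There it is a sum of label cut-offs times mean-zero functions of `x^i` that
equal 1 wherever the matching cut-off is active (`exists_eq_sum_circleDeriv`). -/

theorem proj_add (y z : ι → ℝ) : proj (y + z) = proj y + proj z := by
  ext i; simp [proj]

theorem proj_surjective : Function.Surjective (proj : (ι → ℝ) → Torus ι) := by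
  intro x
  choose y hy using fun i => QuotientAddGroup.mk_surjective (x i)
  exact ⟨y, funext hy⟩

theorem Smooth.add [Fintype ι] {f g : Torus ι → ℝ} (hf : Smooth f) (hg : Smooth g) :
    Smooth fun x => f x + g x :=
  ContDiff.add hf hg

theorem Smooth.mul [Fintype ι] {f g : Torus ι → ℝ} (hf : Smooth f) (hg : Smooth g) :
    Smooth fun x => f x * g x :=
  ContDiff.mul hf hg

theorem Smooth.const [Fintype ι] (c : ℝ) : Smooth fun _ : Torus ι => c :=
  contDiff_const

theorem Smooth.sum [Fintype ι] {κ : Type} [Fintype κ] {f : κ → Torus ι → ℝ}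
    (hf : ∀ k, Smooth (f k)) : Smooth fun x => ∑ k, f k x :=
  ContDiff.sum fun k _ => hf k

theorem Smooth.prod [Fintype ι] {κ : Type} [Fintype κ] {f : κ → Torus ι → ℝ}
    (hf : ∀ k, Smooth (f k)) : Smooth fun x => ∏ k, f k x :=
  contDiff_prod fun k _ => hf k

theorem Smooth.inv [Fintype ι] {f : Torus ι → ℝ} (hf : Smooth f) (h0 : ∀ x, f x ≠ 0) :
    Smooth fun x => (f x)⁻¹ :=
  ContDiff.inv hf fun y => h0 (proj y)

theorem Smooth.sqrt [Fintype ι] {f : Torus ι → ℝ} (hf : Smooth f) (h0 : ∀ x, f x ≠ 0) :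
    Smooth fun x => Real.sqrt (f x) :=
  ContDiff.sqrt hf fun y => h0 (proj y)

theorem CircleSmooth.comp_eval [Fintype ι] {h : UnitAddCircle → ℝ} (hh : CircleSmooth h) (i : ι) :
    Smooth fun x => h (x i) :=
  ContDiff.comp (g := fun s : ℝ => h (s : UnitAddCircle)) hh (contDiff_apply ℝ ℝ i)

/-- A smooth function on the torus becomes positive after adding a constant. -/
theorem Smooth.exists_add_const_pos [Fintype ι] {f : Torus ι → ℝ} (hf : Smooth f) :
    ∃ C : ℝ, ∀ x, 0 < f x + C := by
  have hc : IsCompact (Set.Icc (0 : ι → ℝ) 1) := isCompact_Icc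
  obtain ⟨C, hC⟩ := hc.exists_bound_of_continuousOn (ContDiff.continuous hf).continuousOn
  refine ⟨C + 1, fun x => ?_⟩
  obtain ⟨y, rfl⟩ := proj_surjective x
  -- Periodicity reduces the bound to the compact unit cube.
  have hy : proj y = proj fun i => Int.fract (y i) := by
    funext i
    simp [proj]
  have := hC (fun i => Int.fract (y i))
    ⟨fun i => Int.fract_nonneg _, fun i => (Int.fract_lt_one _).le⟩
  rw [← hy, Real.norm_eq_abs] at this
  linarith [(abs_le.mp this).1]

theorem SpacetimeSmooth.add [Fintype ι] {T : ℝ} {f g : ℝ → Torus ι → ℝ}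
    (hf : SpacetimeSmooth T f) (hg : SpacetimeSmooth T g) :
    SpacetimeSmooth T fun t x => f t x + g t x :=
  ContDiffOn.add hf hg

theorem SpacetimeSmooth.mul [Fintype ι] {T : ℝ} {f g : ℝ → Torus ι → ℝ}
    (hf : SpacetimeSmooth T f) (hg : SpacetimeSmooth T g) :
    SpacetimeSmooth T fun t x => f t x * g t x :=
  ContDiffOn.mul hf hg

theorem Smooth.spacetime [Fintype ι] {f : Torus ι → ℝ} (hf : Smooth f) (T : ℝ) :
    SpacetimeSmooth T fun _ x => f x :=
  ContDiff.contDiffOn (ContDiff.comp (g := fun y : ι → ℝ => f (proj y)) hf contDiff_snd)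

theorem SpacetimeSmooth.smooth [Fintype ι] {T : ℝ} {f : ℝ → Torus ι → ℝ}
    (hf : SpacetimeSmooth T f) {t : ℝ} (ht : t ∈ Set.Icc 0 T) : Smooth (f t) := by
  have : ContDiffOn ℝ ∞ (fun y : ι → ℝ => f t (proj y)) Set.univ :=
    ContDiffOn.comp (g := fun q : ℝ × (ι → ℝ) => f q.1 (proj q.2)) hf
      (contDiff_prodMk_right t).contDiffOn fun y _ => ⟨ht, trivial⟩
  exact contDiffOn_univ.mp this

theorem SpacetimeSmooth.hasDerivWithinAt [Fintype ι] {T : ℝ} {f : ℝ → Torus ι → ℝ}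
    (hf : SpacetimeSmooth T f) {t : ℝ} (ht : t ∈ Set.Icc 0 T) (x : Torus ι) :
    HasDerivWithinAt (fun τ => f τ x) (dt T f t x) (Set.Icc 0 T) t := by
  obtain ⟨y, rfl⟩ := proj_surjective x
  have : ContDiffOn ℝ ∞ (fun τ : ℝ => f τ (proj y)) (Set.Icc 0 T) :=
    ContDiffOn.comp (g := fun q : ℝ × (ι → ℝ) => f q.1 (proj q.2)) hf
      (contDiff_prodMk_left y).contDiffOn fun τ hτ => ⟨hτ, trivial⟩
  exact ((this.differentiableOn (by simp)) t ht).hasDerivWithinAt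

theorem dt_eq {X : Type} {T : ℝ} (hT : 0 < T) {f : ℝ → X → ℝ} {t : ℝ} (ht : t ∈ Set.Icc 0 T)
    {x : X} {f' : ℝ} (h : HasDerivWithinAt (fun τ => f τ x) f' (Set.Icc 0 T) t) :
    dt T f t x = f' :=
  h.derivWithin (uniqueDiffOn_Icc hT t ht)

variable [DecidableEq ι]

theorem proj_single_zero (i : ι) : proj (Pi.single i (0 : ℝ)) = 0 := by
  ext j; simp [proj]

theorem Smooth.hasDerivAt [Fintype ι] {f : Torus ι → ℝ} (hf : Smooth f) (i : ι) (x : Torus ι) :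
    HasDerivAt (fun s : ℝ => f (x + proj (Pi.single i s))) (pd i f x) 0 := by
  obtain ⟨y, rfl⟩ := proj_surjective x
  have h1 : ContDiff ℝ ∞ fun s : ℝ => f (proj (y + Pi.single i s)) :=
    ContDiff.comp (g := fun y : ι → ℝ => f (proj y)) hf
      (contDiff_const.add (contDiff_single (𝕜 := ℝ) (fun _ : ι => ℝ) ∞ i))
  simp only [proj_add] at h1
  exact (h1.differentiable (by simp) 0).hasDerivAt

theorem pd_eq {f : Torus ι → ℝ} {i : ι} {x : Torus ι} {f' : ℝ}
    (h : HasDerivAt (fun s : ℝ => f (x + proj (Pi.single i s))) f' 0) : pd i f x = f' :=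
  h.deriv

theorem pd_add [Fintype ι] {f g : Torus ι → ℝ} (hf : Smooth f) (hg : Smooth g) (i : ι)
    (x : Torus ι) : pd i (fun z => f z + g z) x = pd i f x + pd i g x :=
  pd_eq ((hf.hasDerivAt i x).add (hg.hasDerivAt i x))

theorem pd_mul [Fintype ι] {f g : Torus ι → ℝ} (hf : Smooth f) (hg : Smooth g) (i : ι)
    (x : Torus ι) : pd i (fun z => f z * g z) x = pd i f x * g x + f x * pd i g x := by
  have h := (hf.hasDerivAt i x).fun_mul (hg.hasDerivAt i x)
  simp only [proj_single_zero, add_zero] at h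
  exact pd_eq h

theorem pd_const (c : ℝ) (i : ι) (x : Torus ι) : pd i (fun _ => c) x = 0 := by
  simp [pd]

theorem pd_sum [Fintype ι] {κ : Type} [Fintype κ] {f : κ → Torus ι → ℝ}
    (hf : ∀ k, Smooth (f k)) (i : ι) (x : Torus ι) :
    pd i (fun z => ∑ k, f k z) x = ∑ k, pd i (f k) x :=
  pd_eq (HasDerivAt.fun_sum fun k _ => (hf k).hasDerivAt i x)

/-- Logarithmic differentiation of a product of functions equal to `1`. -/
theorem sum_pd_div_eq_zero [Fintype ι] {κ : Type} [Fintype κ] {w : κ → Torus ι → ℝ}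
    (hw : ∀ k, Smooth (w k)) (h1 : ∀ x, ∏ k, w k x = 1) (i : ι) (x : Torus ι) :
    ∑ k, (w k x)⁻¹ * pd i (w k) x = 0 := by
  classical
  have h := HasDerivAt.fun_finsetProd (u := Finset.univ) fun k _ => (hw k).hasDerivAt i x
  simp only [h1, proj_single_zero, add_zero] at h
  have h0 := h.unique (hasDerivAt_const (0 : ℝ) (1 : ℝ))
  rw [← h0]
  refine Finset.sum_congr rfl fun k _ => ?_
  have := h1 x
  rw [← Finset.mul_prod_erase _ _ (Finset.mem_univ k)] at this
  rw [smul_eq_mul, eq_inv_of_mul_eq_one_right this]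

end Calculus

/-! ### Levi-Civita calculus in coordinates -/

section Geometry

variable {ι : Type} [Fintype ι] (g : Metric ι)

theorem Metric.symm (x : Torus ι) (i j : ι) : g.comp x i j = g.comp x j i := by
  simpa using congrFun (congrFun (g.posDef x).isHermitian.symm i) j

variable [DecidableEq ι]

theorem Metric.inv_symm (x : Torus ι) (i j : ι) : (g.comp x)⁻¹ i j = (g.comp x)⁻¹ j i := by
  simpa using congrFun (congrFun (g.posDef x).isHermitian.inv.symm i) j

theorem Metric.isUnit_det (x : Torus ι) : IsUnit (g.comp x).det :=
  (g.posDef x).det_pos.ne'.isUnit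

theorem Metric.pd_symm (k i j : ι) (x : Torus ι) :
    pd k (fun z => g.comp z i j) x = pd k (fun z => g.comp z j i) x := by
  simp only [g.symm _ i j]

theorem sum_comp_mul_christoffel (i j l : ι) (x : Torus ι) :
    ∑ k, g.comp x k i * christoffel g k j l x =
      (1 / 2 : ℝ) * (pd j (fun z => g.comp z l i) x + pd l (fun z => g.comp z j i) x
        - pd i (fun z => g.comp z j l) x) := by
  set D : ι → ℝ := fun q => pd j (fun z => g.comp z l q) x + pd l (fun z => g.comp z j q) x
        - pd q (fun z => g.comp z j l) x with hD
  have h1 : (g.comp x).mulVec ((g.comp x)⁻¹.mulVec D) = D := by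
    rw [Matrix.mulVec_mulVec, Matrix.mul_nonsing_inv _ (g.isUnit_det x), Matrix.one_mulVec]
  have h2 := congrFun h1 i
  simp only [Matrix.mulVec, dotProduct] at h2
  change _ = 1 / 2 * D i
  rw [← h2, Finset.mul_sum]
  refine Finset.sum_congr rfl fun k _ => ?_
  rw [g.symm x k i]
  simp only [christoffel, hD]
  ring

/-- The covariant components of the acceleration `∇_v v`, without Christoffel symbols:
`v^j ∂_j v_i - (1/2) (∂_i g_{jl}) v^j v^l`. -/
def accForm (v : Torus ι → ι → ℝ) (x : Torus ι) (i : ι) : ℝ :=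
  ∑ j, v x j * pd j (fun z => lower g v z i) x
    - (1 / 2 : ℝ) * ∑ j, ∑ l, pd i (fun z => g.comp z j l) x * (v x j * v x l)

theorem sum_christoffel_lower (v : Torus ι → ι → ℝ) (j i : ι) (x : Torus ι) :
    ∑ k, christoffel g k j i x * lower g v x k =
      ∑ l, (1 / 2 : ℝ) * (pd j (fun z => g.comp z i l) x + pd i (fun z => g.comp z j l) x
        - pd l (fun z => g.comp z j i) x) * v x l := by
  simp only [← sum_comp_mul_christoffel, lower, Finset.mul_sum, Finset.sum_mul]
  rw [Finset.sum_comm]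
  refine Finset.sum_congr rfl fun l _ => Finset.sum_congr rfl fun k _ => ?_
  rw [g.symm x l k]; ring

/-- Two of the three Christoffel terms are exchanged by swapping `j` and `l`, so they cancel against
the symmetric `v^j v^l`; only the `∂_i g_{jl}` term survives. -/
theorem sum_mul_covDerivForm_lower (v : Torus ι → ι → ℝ) (x : Torus ι) (i : ι) :
    ∑ j, v x j * covDerivForm g (lower g v) j i x = accForm g v x i := by
  simp only [covDerivForm, accForm, mul_sub, Finset.sum_sub_distrib]
  congr 1
  simp only [sum_christoffel_lower]
  have h : ∑ j, ∑ l, v x j * (pd j (fun z => g.comp z i l) x * v x l) =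
      ∑ j, ∑ l, v x j * (pd l (fun z => g.comp z j i) x * v x l) := by
    rw [Finset.sum_comm]
    refine Finset.sum_congr rfl fun j _ => Finset.sum_congr rfl fun l _ => ?_
    rw [g.pd_symm l i j]; ring
  have : ∀ j, v x j * ∑ l, (1 / 2 : ℝ) * (pd j (fun z => g.comp z i l) x
      + pd i (fun z => g.comp z j l) x - pd l (fun z => g.comp z j i) x) * v x l =
      (1 / 2 : ℝ) * (∑ l, v x j * (pd j (fun z => g.comp z i l) x * v x l)
        - ∑ l, v x j * (pd l (fun z => g.comp z j i) x * v x l)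
        + ∑ l, pd i (fun z => g.comp z j l) x * (v x j * v x l)) := by
    intro j
    rw [← Finset.sum_sub_distrib, ← Finset.sum_add_distrib, Finset.mul_sum, Finset.mul_sum]
    exact Finset.sum_congr rfl fun l _ => by ring
  rw [Finset.sum_congr rfl fun j _ => this j, ← Finset.mul_sum, Finset.sum_add_distrib,
    Finset.sum_sub_distrib, h]
  ring

/-- Metric compatibility: lowering an index commutes with `∇`. This links the vector form of the
Euler equation to `accForm`, where no inverse metric appears. -/
theorem sum_comp_mul_acceleration {v : Torus ι → ι → ℝ} (hv : ∀ i, Smooth fun x => v x i)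
    (x : Torus ι) (i : ι) :
    ∑ k, g.comp x k i * ∑ j, v x j * covDerivVec g v j k x = accForm g v x i := by
  have h1 : ∀ j, pd j (fun z => lower g v z i) x =
      ∑ k, (pd j (fun z => g.comp z k i) x * v x k + g.comp x k i * pd j (fun z => v z k) x) := by
    intro j
    unfold lower
    rw [pd_sum fun k => (g.smooth k i).mul (hv k)]
    exact Finset.sum_congr rfl fun k _ => pd_mul (g.smooth k i) (hv k) j x
  rw [← sum_mul_covDerivForm_lower]
  simp only [Finset.mul_sum]
  rw [Finset.sum_comm]
  refine Finset.sum_congr rfl fun j _ => ?_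
  rw [covDerivForm, sum_christoffel_lower, h1]
  have h2 : ∀ k, g.comp x k i * (v x j * covDerivVec g v j k x) =
      v x j * (g.comp x k i * pd j (fun z => v z k) x
        + ∑ l, g.comp x k i * christoffel g k j l x * v x l) := by
    intro k
    simp only [covDerivVec, mul_assoc, ← Finset.mul_sum]
    ring
  simp only [h2, ← Finset.mul_sum, Finset.sum_add_distrib]
  rw [Finset.sum_comm (f := fun k l => g.comp x k i * christoffel g k j l x * v x l)]
  simp only [← Finset.sum_mul, sum_comp_mul_christoffel]
  rw [add_comm (∑ k, _) (∑ k, g.comp x k i * _), add_sub_assoc, ← Finset.sum_sub_distrib]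
  congr 2
  refine Finset.sum_congr rfl fun l _ => ?_
  rw [g.pd_symm j i l, g.pd_symm l j i]
  ring_nf

/-- In `Γ^k_{ki}` two terms cancel by symmetry of `g`, leaving the logarithmic derivative of the
volume density. In this form the effect of the fibre weights is easy to read off. -/
theorem divergence_eq (v : Torus ι → ι → ℝ) (x : Torus ι) :
    divergence g v x = ∑ k, pd k (fun z => v z k) x
      + (1 / 2 : ℝ) * ∑ i, v x i * ∑ k, ∑ l, (g.comp x)⁻¹ k l * pd i (fun z => g.comp z k l) x := by
  simp only [divergence, covDerivVec, Finset.sum_add_distrib]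
  congr 1
  rw [Finset.sum_comm, Finset.mul_sum]
  refine Finset.sum_congr rfl fun i _ => ?_
  rw [← Finset.sum_mul]
  have h : ∑ k, ∑ l, (g.comp x)⁻¹ k l * pd k (fun z => g.comp z i l) x =
      ∑ k, ∑ l, (g.comp x)⁻¹ k l * pd l (fun z => g.comp z k i) x := by
    rw [Finset.sum_comm]
    refine Finset.sum_congr rfl fun k _ => Finset.sum_congr rfl fun l _ => ?_
    rw [g.inv_symm x l k, g.pd_symm l i k]
  simp only [christoffel, mul_sub, mul_add, Finset.sum_sub_distrib, Finset.sum_add_distrib,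
    ← Finset.mul_sum, h]
  ring

/-- The momentum equation with a lowered index implies the one for the vector field. -/
theorem eq_neg_grad_of_lower {X : ι → ℝ} {f : Torus ι → ℝ} {x : Torus ι}
    (h : ∀ i, ∑ k, g.comp x k i * X k = -pd i f x) (k : ι) : X k = -grad g f x k := by
  have h1 : (g.comp x).mulVec X = fun i => -pd i f x := by
    funext i
    rw [← h i]
    exact Finset.sum_congr rfl fun k _ => congrArg (· * X k) (g.symm x i k)
  have h2 : X = (g.comp x)⁻¹.mulVec fun i => -pd i f x := by
    rw [← h1, Matrix.mulVec_mulVec, Matrix.nonsing_inv_mul _ (g.isUnit_det x), Matrix.one_mulVec]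
  rw [h2]
  simp [Matrix.mulVec, dotProduct, grad]

end Geometry

/-! ### Warped torus extensions and their Euler equations -/

section Extension

variable {ι : Type} {m : ℕ}

theorem Smooth.comp_base [Fintype ι] {f : Torus ι → ℝ} (hf : Smooth f) :
    Smooth fun z : Torus (ι ⊕ Fin m) => f (base z) :=
  ContDiff.comp (g := fun y : ι → ℝ => f (proj y)) hf
    (f := fun y : ι ⊕ Fin m → ℝ => fun i => y (Sum.inl i))
    (contDiff_pi.mpr fun i => contDiff_apply ℝ ℝ (Sum.inl i))

theorem SpacetimeSmooth.comp_base [Fintype ι] {T : ℝ} {f : ℝ → Torus ι → ℝ}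
    (hf : SpacetimeSmooth T f) :
    SpacetimeSmooth T fun t (z : Torus (ι ⊕ Fin m)) => f t (base z) :=
  ContDiffOn.comp (g := fun q : ℝ × (ι → ℝ) => f q.1 (proj q.2)) hf
    (f := fun q : ℝ × (ι ⊕ Fin m → ℝ) => (q.1, fun i => q.2 (Sum.inl i)))
    (contDiff_fst.prodMk (contDiff_pi.mpr fun i =>
      (contDiff_apply ℝ ℝ (Sum.inl i)).comp contDiff_snd)).contDiffOn
    fun _ hq => ⟨hq.1, trivial⟩

theorem pd_inl_comp_base [DecidableEq ι] (f : Torus ι → ℝ) (i : ι) (z : Torus (ι ⊕ Fin m)) :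
    pd (Sum.inl i) (fun z => f (base z)) z = pd i f (base z) := by
  have h : ∀ r : ℝ, base (z + proj (Pi.single (Sum.inl i) r)) =
      base z + proj (Pi.single i r) := by
    intro r
    funext j
    by_cases h : j = i
    · subst h; simp [base, proj]
    · simp [base, proj, h]
  simp [pd, h]

theorem pd_inr_comp_base [DecidableEq ι] (f : Torus ι → ℝ) (s : Fin m) (z : Torus (ι ⊕ Fin m)) :
    pd (Sum.inr s) (fun z => f (base z)) z = 0 := by
  have h : ∀ r : ℝ, base (z + proj (Pi.single (Sum.inr s) r)) = base z := by
    intro r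
    funext j
    simp [base, proj]
  simp [pd, h]

variable [Fintype ι] (g : Metric ι)

/-- The metric `g_{ij} dx^i dx^j + ∑ s, w_s (dθ^s)^2` on `M × (ℝ/ℤ)^m`. -/
def extMetric (w : Fin m → Torus ι → ℝ) (hw : ∀ s, Smooth (w s)) (hpos : ∀ s x, 0 < w s x) :
    Metric (ι ⊕ Fin m) where
  comp z := Matrix.fromBlocks (g.comp (base z)) 0 0 (Matrix.diagonal fun s => w s (base z))
  smooth := by
    rintro (i | s) (j | s')
    · exact (g.smooth i j).comp_base
    · exact Smooth.const 0
    · exact Smooth.const 0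
    · by_cases h : s = s'
      · subst h
        simpa using (hw s).comp_base
      · simpa [h] using Smooth.const 0
  posDef z := by
    refine Matrix.PosDef.of_dotProduct_mulVec_pos ?_ ?_
    · refine Matrix.IsHermitian.fromBlocks (g.posDef _).isHermitian (by simp) ?_
      exact Matrix.isHermitian_diagonal _
    · intro v hv
      obtain ⟨a, b, rfl⟩ : ∃ a b, v = Sum.elim a b :=
        ⟨v ∘ Sum.inl, v ∘ Sum.inr, (Sum.elim_comp_inl_inr v).symm⟩
      have e : star (Sum.elim a b) ⬝ᵥ (Matrix.fromBlocks (g.comp (base z)) 0 0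
          (Matrix.diagonal fun s => w s (base z))).mulVec (Sum.elim a b) =
          star a ⬝ᵥ (g.comp (base z)).mulVec a + ∑ s, w s (base z) * b s ^ 2 := by
        simp only [Matrix.fromBlocks_mulVec, dotProduct, Fintype.sum_sum_type]
        simp [Matrix.mulVec, dotProduct, Matrix.diagonal_apply]
        exact Finset.sum_congr rfl fun s _ => by ring
      rw [e]
      have hb : ∀ s ∈ Finset.univ, 0 ≤ w s (base z) * b s ^ 2 := fun s _ =>
        mul_nonneg (hpos s _).le (sq_nonneg _)
      by_cases ha : a = 0
      · subst ha
        have hb0 : ∃ s, b s ≠ 0 := by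
          by_contra! hb0
          exact hv (by ext (i | s) <;> simp [hb0])
        obtain ⟨s, hs⟩ := hb0
        simp only [Matrix.mulVec_zero, dotProduct_zero, zero_add]
        exact Finset.sum_pos' hb ⟨s, Finset.mem_univ s, mul_pos (hpos s _) (by positivity)⟩
      · exact add_pos_of_pos_of_nonneg ((g.posDef _).dotProduct_mulVec_pos ha)
          (Finset.sum_nonneg hb)

/-- The vector field `v^i ∂/∂x^i + ∑ s, c_s ∂/∂θ^s` on `M × (ℝ/ℤ)^m`. -/
def extField (v : Torus ι → ι → ℝ) (c : Fin m → Torus ι → ℝ) (z : Torus (ι ⊕ Fin m)) :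
    ι ⊕ Fin m → ℝ :=
  Sum.elim (v (base z)) fun s => c s (base z)

variable {w : Fin m → Torus ι → ℝ} (hw : ∀ s, Smooth (w s)) (hpos : ∀ s x, 0 < w s x)

theorem lower_extField_inl (v : Torus ι → ι → ℝ) (c : Fin m → Torus ι → ℝ)
    (z : Torus (ι ⊕ Fin m)) (i : ι) :
    lower (extMetric g w hw hpos) (extField v c) z (Sum.inl i) = lower g v (base z) i := by
  simp [lower, extMetric, extField]

theorem lower_extField_inr (v : Torus ι → ι → ℝ) (c : Fin m → Torus ι → ℝ)
    (z : Torus (ι ⊕ Fin m)) (s : Fin m) :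
    lower (extMetric g w hw hpos) (extField v c) z (Sum.inr s) = w s (base z) * c s (base z) := by
  simp [lower, extMetric, extField, Matrix.diagonal_apply]

theorem isExtensionMetric_extMetric (h1 : ∀ x, ∏ s, w s x = 1) :
    IsExtensionMetric g (extMetric g w hw hpos) :=
  ⟨w, hw, h1, fun _ => rfl⟩

theorem isExtensionFlow_extField {T : ℝ} (u : ℝ → Torus ι → ι → ℝ) {c : Fin m → ℝ → Torus ι → ℝ}
    (hc : ∀ s, SpacetimeSmooth T (c s)) :
    IsExtensionFlow T u fun t => extField (u t) fun s => c s t :=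
  ⟨c, hc, fun _ _ _ => ⟨fun _ => rfl, fun _ => rfl⟩⟩

theorem IsFlow.dt_lower {T : ℝ} (hT : 0 < T) {u : ℝ → Torus ι → ι → ℝ} (hu : IsFlow T u)
    {t : ℝ} (ht : t ∈ Set.Icc 0 T) (x : Torus ι) (i : ι) :
    dt T (fun τ z => lower g (u τ) z i) t x =
      ∑ k, g.comp x k i * dt T (fun τ z => u τ z k) t x :=
  dt_eq hT ht (HasDerivWithinAt.fun_sum fun k _ =>
    ((hu k).hasDerivWithinAt ht x).const_mul (g.comp x k i))

variable [DecidableEq ι]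

theorem extMetric_inv (z : Torus (ι ⊕ Fin m)) :
    ((extMetric g w hw hpos).comp z)⁻¹ = Matrix.fromBlocks (g.comp (base z))⁻¹ 0 0
      (Matrix.diagonal fun s => (w s (base z))⁻¹) := by
  refine Matrix.inv_eq_right_inv ?_
  simp [extMetric, Matrix.fromBlocks_multiply, Matrix.mul_nonsing_inv _ (g.isUnit_det _),
    (hpos _ _).ne']

theorem pd_extMetric_inl (i : ι) (z : Torus (ι ⊕ Fin m)) :
    (∀ j l, pd (Sum.inl i) (fun z => (extMetric g w hw hpos).comp z (Sum.inl j) (Sum.inl l)) z =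
      pd i (fun x => g.comp x j l) (base z)) ∧
    (∀ j s, pd (Sum.inl i) (fun z => (extMetric g w hw hpos).comp z (Sum.inl j) (Sum.inr s)) z =
      0) ∧
    (∀ s l, pd (Sum.inl i) (fun z => (extMetric g w hw hpos).comp z (Sum.inr s) (Sum.inl l)) z =
      0) ∧
    (∀ s s', pd (Sum.inl i) (fun z => (extMetric g w hw hpos).comp z (Sum.inr s) (Sum.inr s')) z =
      if s = s' then pd i (w s) (base z) else 0) := by
  refine ⟨fun j l => pd_inl_comp_base (fun x => g.comp x j l) i z, fun j s => pd_const 0 _ _,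
    fun s l => pd_const 0 _ _, fun s s' => ?_⟩
  split_ifs with h
  · subst h
    simp only [extMetric, Matrix.fromBlocks_apply₂₂, Matrix.diagonal_apply_eq]
    exact pd_inl_comp_base (w s) i z
  · simpa [extMetric, h] using pd_const 0 _ _

theorem pd_extMetric_inr (s : Fin m) (z : Torus (ι ⊕ Fin m)) (a b : ι ⊕ Fin m) :
    pd (Sum.inr s) (fun z => (extMetric g w hw hpos).comp z a b) z = 0 :=
  pd_inr_comp_base (fun x => Matrix.fromBlocks (g.comp x) 0 0
    (Matrix.diagonal fun s => w s x) a b) s z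

/-- The only new contribution is centrifugal: fibre lengths vary over the base, while nothing
depends on `θ`. -/
theorem accForm_extField_inl (v : Torus ι → ι → ℝ) (c : Fin m → Torus ι → ℝ)
    (z : Torus (ι ⊕ Fin m)) (i : ι) :
    accForm (extMetric g w hw hpos) (extField v c) z (Sum.inl i) = accForm g v (base z) i
      - (1 / 2 : ℝ) * ∑ s, pd i (w s) (base z) * c s (base z) ^ 2 := by
  obtain ⟨h1, h2, h3, h4⟩ := pd_extMetric_inl g hw hpos i z
  simp only [accForm, Fintype.sum_sum_type, h1, h2, h3, h4, lower_extField_inl,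
    pd_inr_comp_base (fun x => lower g v x i), pd_inl_comp_base (fun x => lower g v x i)]
  simp only [extField, Sum.elim_inl, Sum.elim_inr, mul_zero, zero_mul, Finset.sum_const_zero,
    add_zero, zero_add, ite_mul, Finset.sum_ite_eq, Finset.mem_univ, if_true]
  simp only [pow_two]
  ring

/-- Rotations in `θ^s` are isometries, so the metric-derivative term drops out and `w_s c_s` is
merely advected. -/
theorem accForm_extField_inr (v : Torus ι → ι → ℝ) (c : Fin m → Torus ι → ℝ)
    (z : Torus (ι ⊕ Fin m)) (s : Fin m) :
    accForm (extMetric g w hw hpos) (extField v c) z (Sum.inr s) =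
      ∑ j, v (base z) j * pd j (fun x => w s x * c s x) (base z) := by
  simp only [accForm, Fintype.sum_sum_type, pd_extMetric_inr, lower_extField_inr,
    pd_inr_comp_base (fun x => w s x * c s x), pd_inl_comp_base (fun x => w s x * c s x)]
  simp [extField]

/-- Since `∏ w_s = 1`, the extension has the volume density of the base, and the swirl is constant
along the fibres. -/
theorem divergence_extField (h1 : ∀ x, ∏ s, w s x = 1) (v : Torus ι → ι → ℝ)
    (c : Fin m → Torus ι → ℝ) (z : Torus (ι ⊕ Fin m)) :
    divergence (extMetric g w hw hpos) (extField v c) z = divergence g v (base z) := by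
  simp only [divergence_eq, Fintype.sum_sum_type, pd_extMetric_inr, extMetric_inv]
  have hd : ∀ i, ∑ s, (w s (base z))⁻¹ * pd i (w s) (base z) = 0 := fun i =>
    sum_pd_div_eq_zero hw h1 i (base z)
  have hv : ∀ k, pd (Sum.inl k) (fun z : Torus (ι ⊕ Fin m) => extField v c z (Sum.inl k)) z =
      pd k (fun x => v x k) (base z) := fun k => pd_inl_comp_base (fun x => v x k) k z
  have hc : ∀ s, pd (Sum.inr s) (fun z : Torus (ι ⊕ Fin m) => extField v c z (Sum.inr s)) z =
      0 := fun s => pd_inr_comp_base (c s) s z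
  have hp := pd_extMetric_inl g hw hpos (z := z)
  simp only [hv, hc, (hp _).1, (hp _).2.1, (hp _).2.2.1, (hp _).2.2.2]
  simp [Matrix.diagonal_apply, hd, extField]

/-- A flow that is incompressible and satisfies the lowered momentum equation is an Euler flow. -/
theorem isEulerFlow_of_lower {T : ℝ} (hT : 0 < T) {u : ℝ → Torus ι → ι → ℝ} (hu : IsFlow T u)
    (hdiv : ∀ t ∈ Set.Icc 0 T, ∀ x, divergence g (u t) x = 0) {p : ℝ → Torus ι → ℝ}
    (hp : SpacetimeSmooth T p)
    (h : ∀ t ∈ Set.Icc 0 T, ∀ x i, dt T (fun τ z => lower g (u τ) z i) t x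
      + accForm g (u t) x i = -pd i (p t) x) : IsEulerFlow g T u := by
  refine ⟨hu, p, hp, fun t ht x => ⟨?_, hdiv t ht x⟩⟩
  refine eq_neg_grad_of_lower g fun i => ?_
  rw [← h t ht x i, hu.dt_lower g hT ht,
    ← sum_comp_mul_acceleration g (fun j => (hu j).smooth ht) x i, ← Finset.sum_add_distrib]
  exact Finset.sum_congr rfl fun k _ => mul_add _ _ _

/-- Swirl variables `b_s = w_s c_s` that are transported by `u` produce a conservative forcing
once it is compensated by `(1/2) ∑ b_s² ∂_i (1/w_s)`. -/
theorem isExtendible_of_transported {T : ℝ} (hT : 0 < T) {u : ℝ → Torus ι → ι → ℝ}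
    (hu : IsIncompressibleFlow g T u) {w : Fin m → Torus ι → ℝ} (hw : ∀ s, Smooth (w s))
    (hpos : ∀ s x, 0 < w s x) (h1 : ∀ x, ∏ s, w s x = 1) {b : Fin m → ℝ → Torus ι → ℝ}
    (hb : ∀ s, SpacetimeSmooth T (b s))
    (htr : ∀ t ∈ Set.Icc 0 T, ∀ x s, dt T (b s) t x + ∑ j, u t x j * pd j (b s t) x = 0)
    {p : ℝ → Torus ι → ℝ} (hp : SpacetimeSmooth T p)
    (heq : ∀ t ∈ Set.Icc 0 T, ∀ x i, dt T (fun τ z => lower g (u τ) z i) t x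
      + accForm g (u t) x i + (1 / 2 : ℝ) * ∑ s, b s t x ^ 2 * pd i (fun z => (w s z)⁻¹) x
        = -pd i (p t) x) :
    IsExtendible g T u := by
  have hwi : ∀ s, Smooth fun x => (w s x)⁻¹ := fun s => (hw s).inv fun x => (hpos s x).ne'
  have hc : ∀ s, SpacetimeSmooth T fun t x => (w s x)⁻¹ * b s t x := fun s =>
    ((hwi s).spacetime T).mul (hb s)
  have hcb : ∀ s x r, w s x * ((w s x)⁻¹ * r) = r := fun s x r =>
    mul_inv_cancel_left₀ (hpos s x).ne' r
  refine ⟨m, extMetric g w hw hpos, _, isExtensionMetric_extMetric g hw hpos h1,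
    isExtensionFlow_extField u hc, ?_⟩
  refine isEulerFlow_of_lower _ hT (p := fun t z => p t (base z)) ?_ ?_ hp.comp_base ?_
  · rintro (i | s)
    · exact (hu.1 i).comp_base
    · exact (hc s).comp_base
  · intro t ht z
    rw [divergence_extField g hw hpos h1]
    exact hu.2 t ht _
  · rintro t ht z (i | s)
    · rw [accForm_extField_inl, pd_inl_comp_base (p t), ← heq t ht (base z) i]
      simp only [lower_extField_inl]
      -- With `c = b/w`, this is `∂(1/w) = -w⁻² ∂w`, obtained by differentiating `w · w⁻¹ = 1`.
      have : ∀ s, pd i (w s) (base z) * ((w s (base z))⁻¹ * b s t (base z)) ^ 2 =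
          -(b s t (base z) ^ 2 * pd i (fun z => (w s z)⁻¹) (base z)) := by
        intro s
        have h2 := pd_mul (hw s) (hwi s) i (base z)
        simp only [mul_inv_cancel₀ (hpos s _).ne', pd_const] at h2
        have h3 : pd i (fun z => (w s z)⁻¹) (base z) =
            -(pd i (w s) (base z) * (w s (base z))⁻¹) * (w s (base z))⁻¹ := by
          rw [← eq_neg_of_add_eq_zero_right h2.symm]
          field_simp [(hpos s (base z)).ne']
        rw [h3]; ring
      simp only [this, Finset.sum_neg_distrib]
      rw [show dt T (fun τ (z : Torus (ι ⊕ Fin m)) => lower g (u τ) (base z) i) t z =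
        dt T (fun τ x => lower g (u τ) x i) t (base z) from rfl]
      ring
    · rw [accForm_extField_inr, pd_inr_comp_base (p t)]
      simp only [lower_extField_inr, hcb, neg_zero]
      exact htr t ht (base z) s

end Extension

/-! ### Functions on the circle and the strip decomposition -/

section Circle

/-- The derivative `h'` of a function on the circle `ℝ/ℤ`. -/
def circleDeriv (h : UnitAddCircle → ℝ) (x : UnitAddCircle) : ℝ :=
  deriv (fun s : ℝ => h (x + (s : UnitAddCircle))) 0

theorem circleDeriv_coe (h : UnitAddCircle → ℝ) (y : ℝ) :
    circleDeriv h (y : UnitAddCircle) = deriv (fun s : ℝ => h (s : UnitAddCircle)) y := by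
  have := deriv_comp_const_add (f := fun s : ℝ => h (s : UnitAddCircle)) y 0
  simp only [AddCircle.coe_add, add_zero] at this
  exact this

theorem pd_comp_eval {ι : Type} [DecidableEq ι] (h : UnitAddCircle → ℝ) (i j : ι) (x : Torus ι) :
    pd i (fun x => h (x j)) x = if i = j then circleDeriv h (x i) else 0 := by
  split_ifs with hij
  · subst hij
    simp [pd, circleDeriv, proj]
  · have : ∀ s : ℝ, proj (Pi.single i s) j = 0 := fun s => by
      simp [proj, Ne.symm hij]
    simp [pd, this]

/-- A periodic function on the line as a function on the circle. -/
def ofPeriodic {f : ℝ → ℝ} (hf : Function.Periodic f 1) : UnitAddCircle → ℝ := hf.lift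

theorem ofPeriodic_coe {f : ℝ → ℝ} (hf : Function.Periodic f 1) (y : ℝ) :
    ofPeriodic hf (y : UnitAddCircle) = f y :=
  hf.lift_coe y

theorem circleSmooth_ofPeriodic {f : ℝ → ℝ} (hf : Function.Periodic f 1) (hs : ContDiff ℝ ∞ f) :
    CircleSmooth (ofPeriodic hf) := by
  simpa only [CircleSmooth, ofPeriodic_coe] using hs

theorem exists_circle_of_periodic {f : ℝ → ℝ} (hf : Function.Periodic f 1) (hs : ContDiff ℝ ∞ f) :
    ∃ h : UnitAddCircle → ℝ, CircleSmooth h ∧ ∀ y : ℝ, h y = f y :=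
  ⟨ofPeriodic hf, circleSmooth_ofPeriodic hf hs, ofPeriodic_coe hf⟩

/-- A smooth periodic function with mean zero is the derivative of a smooth function on the
circle. -/
theorem exists_circleDeriv_eq {f : ℝ → ℝ} (hf : Function.Periodic f 1) (hs : ContDiff ℝ ∞ f)
    (h0 : ∫ y in (0 : ℝ)..1, f y = 0) :
    ∃ H : UnitAddCircle → ℝ, CircleSmooth H ∧ ∀ y : ℝ, circleDeriv H y = f y := by
  have hc := hs.continuous
  have hd : ∀ y, HasDerivAt (fun y => ∫ s in (0 : ℝ)..y, f s) (f y) y := fun y =>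
    intervalIntegral.integral_hasDerivAt_right (hc.intervalIntegrable _ _)
      (hc.stronglyMeasurableAtFilter _ _) hc.continuousAt
  -- Mean zero is exactly what makes the primitive periodic.
  have hper : Function.Periodic (fun y => ∫ s in (0 : ℝ)..y, f s) 1 := by
    intro y
    have h1 := hf.intervalIntegral_add_eq y 0
    rw [zero_add, h0] at h1
    change ∫ s in (0 : ℝ)..(y + 1), f s = _
    rw [← intervalIntegral.integral_add_adjacent_intervals (hc.intervalIntegrable 0 y)
      (hc.intervalIntegrable y (y + 1)), h1, add_zero]
  have hsm : ContDiff ℝ ∞ fun y => ∫ s in (0 : ℝ)..y, f s := by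
    rw [contDiff_infty_iff_deriv]
    refine ⟨fun y => (hd y).differentiableAt, ?_⟩
    rwa [show deriv (fun y => ∫ s in (0 : ℝ)..y, f s) = f from funext fun y => (hd y).deriv]
  obtain ⟨H, hH, hHf⟩ := exists_circle_of_periodic hper hsm
  refine ⟨H, hH, fun y => ?_⟩
  simp only [circleDeriv_coe, hHf]
  exact (hd y).deriv

theorem smoothTransition_add_one_sub (x : ℝ) :
    Real.smoothTransition x + Real.smoothTransition (1 - x) = 1 := by
  have := (Real.smoothTransition.pos_denom x).ne'
  unfold Real.smoothTransition
  rw [sub_sub_cancel, add_comm (expNegInvGlue (1 - x)), ← add_div, div_self this]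

/-- A smooth periodic function with mean zero that equals `1` on the arc `[-1/16, 13/16]`. -/
theorem exists_mean_zero_eq_one : ∃ f : ℝ → ℝ, Function.Periodic f 1 ∧ ContDiff ℝ ∞ f ∧
    ∫ y in (0 : ℝ)..1, f y = 0 ∧ ∀ y ∈ Set.Icc (-1 / 16 : ℝ) (13 / 16), f y = 1 := by
  -- A bump about `7/8`, positive only within `1/16` of it modulo 1; subtracting its normalization
  -- from 1 gives mean zero.
  let B : ℝ → ℝ := fun y =>
    Real.smoothTransition (Real.cos (2 * Real.pi * (y - 7 / 8)) - Real.cos (Real.pi / 8))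
  have hBper : Function.Periodic B 1 := by
    intro y
    simp only [B]
    rw [show 2 * Real.pi * (y + 1 - 7 / 8) = 2 * Real.pi * (y - 7 / 8) + 2 * Real.pi by ring,
      Real.cos_add_two_pi]
  have hBs : ContDiff ℝ ∞ B := by
    refine Real.smoothTransition.contDiff.comp ?_
    fun_prop
  have hpos : 0 < ∫ y in (0 : ℝ)..1, B y := by
    refine intervalIntegral.integral_pos one_pos hBs.continuous.continuousOn
      (fun y _ => Real.smoothTransition.nonneg _) ⟨7 / 8, by norm_num, ?_⟩
    refine Real.smoothTransition.pos_of_pos ?_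
    rw [sub_self, mul_zero, sub_pos]
    exact Real.cos_lt_cos_of_nonneg_of_le_pi le_rfl (by linarith [Real.pi_pos])
      (by linarith [Real.pi_pos])
  set c := ∫ y in (0 : ℝ)..1, B y with hc
  refine ⟨fun y => 1 - c⁻¹ * B y, fun y => by simp [hBper y], by fun_prop, ?_, fun y hy => ?_⟩
  · have hi : IntervalIntegrable (fun y => c⁻¹ * B y) MeasureTheory.volume 0 1 :=
      (continuous_const.mul hBs.continuous).intervalIntegrable _ _
    rw [intervalIntegral.integral_sub intervalIntegrable_const hi,
      intervalIntegral.integral_const_mul, ← hc, inv_mul_cancel₀ hpos.ne']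
    simp
  · have : B y = 0 := by
      refine Real.smoothTransition.zero_of_nonpos (sub_nonpos.mpr ?_)
      have hp := Real.pi_pos
      rw [← Real.cos_neg, show -(2 * Real.pi * (y - 7 / 8)) = 2 * Real.pi * (7 / 8 - y) by ring]
      -- The angle `2π(7/8 - y)` lies in `[π/8, 15π/8]`; beyond `π` it is reflected to `2π` minus
      -- itself, so that monotonicity of cosine on `[0, π]` applies.
      rcases le_total (7 / 8 - y) (1 / 2) with h | h
      · exact Real.cos_le_cos_of_nonneg_of_le_pi (by linarith) (by nlinarith) (by nlinarith [hy.2])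
      · rw [← Real.cos_neg, ← Real.cos_add_two_pi]
        exact Real.cos_le_cos_of_nonneg_of_le_pi (by linarith) (by nlinarith) (by nlinarith [hy.1])
    simp [this]

/-- A smooth cut-off function on the circle which vanishes off the arc `[-1/16, 9/16]`. -/
theorem exists_cutoff : ∃ χ : ℝ → ℝ, Function.Periodic χ 1 ∧ ContDiff ℝ ∞ χ ∧
    (∀ y, χ y + χ (y + 1 / 2) = 1) ∧
    ∀ y ∈ Set.Ioo (9 / 16 : ℝ) (15 / 16), χ y = 0 := by
  have hp := Real.pi_pos
  have hs : 0 < Real.sin (Real.pi / 8) := Real.sin_pos_of_pos_of_lt_pi (by linarith) (by linarith)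
  -- A half-period shift flips the sine, turning the argument `x` into `1 - x`. The factor is chosen
  -- so that the argument is nonpositive once `sin(2πy) ≤ -sin(π/8)`, i.e. for `y` in `[9/16,
  -- 15/16]` modulo 1.
  refine ⟨fun y => Real.smoothTransition
    (1 / 2 + (2 * Real.sin (Real.pi / 8))⁻¹ * Real.sin (2 * Real.pi * y)), ?_, ?_, ?_, ?_⟩
  · intro y
    simp only
    rw [show 2 * Real.pi * (y + 1) = 2 * Real.pi * y + 2 * Real.pi by ring, Real.sin_add_two_pi]
  · exact Real.smoothTransition.contDiff.comp (by fun_prop)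
  · intro y
    have h := smoothTransition_add_one_sub
      (1 / 2 + (2 * Real.sin (Real.pi / 8))⁻¹ * Real.sin (2 * Real.pi * y))
    simp only
    rw [show 2 * Real.pi * (y + 1 / 2) = 2 * Real.pi * y + Real.pi by ring, Real.sin_add_pi]
    refine Eq.trans ?_ h
    congr 2
    ring
  · intro y hy
    refine Real.smoothTransition.zero_of_nonpos ?_
    have h : Real.sin (Real.pi / 8) ≤ -Real.sin (2 * Real.pi * y) := by
      rw [← Real.cos_pi_div_two_sub, ← Real.cos_add_pi_div_two,
        show 2 * Real.pi * y + Real.pi / 2 = 2 * Real.pi * (y - 3 / 4) + 2 * Real.pi by ring,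
        Real.cos_add_two_pi, ← Real.cos_abs (2 * Real.pi * (y - 3 / 4))]
      refine Real.cos_le_cos_of_nonneg_of_le_pi (abs_nonneg _) (by linarith) (abs_le.mpr ?_)
      constructor <;> nlinarith [hy.1, hy.2]
    have h2 : (2 * Real.sin (Real.pi / 8))⁻¹ * Real.sin (2 * Real.pi * y) ≤
        (2 * Real.sin (Real.pi / 8))⁻¹ * -Real.sin (Real.pi / 8) :=
      mul_le_mul_of_nonneg_left (by linarith) (by positivity)
    have h3 : (2 * Real.sin (Real.pi / 8))⁻¹ * -Real.sin (Real.pi / 8) = -(1 / 2) := by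
      field_simp
    linarith

/-- On the strip `0 ≤ y - a ≤ 1/4` of the two-torus, every smooth function of `y` is a finite
combination of derivatives of smooth functions of `y`, with coefficients depending on `a`. -/
theorem exists_eq_sum_circleDeriv {h : UnitAddCircle → ℝ} (hh : CircleSmooth h) :
    ∃ χ H : Fin 3 → UnitAddCircle → ℝ, (∀ k, CircleSmooth (χ k)) ∧ (∀ k, CircleSmooth (H k)) ∧
      ∀ a : UnitAddCircle, ∀ r ∈ Set.Icc (0 : ℝ) (1 / 4),
        h (a + (r : UnitAddCircle)) =
          ∑ k, χ k a * circleDeriv (H k) (a + (r : UnitAddCircle)) := by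
  set c := ∫ y in (0 : ℝ)..1, h (y : UnitAddCircle) with hc
  have hper : Function.Periodic (fun y : ℝ => h (y : UnitAddCircle) - c) 1 := fun y => by simp
  have hcont : Continuous fun y : ℝ => h (y : UnitAddCircle) := ContDiff.continuous hh
  obtain ⟨H₀, hH₀, hd₀⟩ := exists_circleDeriv_eq hper (ContDiff.sub hh contDiff_const) (by
    rw [intervalIntegral.integral_sub (hcont.intervalIntegrable _ _) (by simp), ← hc]
    simp)
  obtain ⟨η, hηp, hηs, hη0, hη1⟩ := exists_mean_zero_eq_one
  obtain ⟨H₁, hH₁, hd₁⟩ := exists_circleDeriv_eq hηp hηs hη0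
  have hηp' : Function.Periodic (fun y => η (y + 1 / 2)) 1 := hηp.add_const _
  obtain ⟨H₂, hH₂, hd₂⟩ := exists_circleDeriv_eq hηp' (by fun_prop) (by
    rw [intervalIntegral.integral_comp_add_right, zero_add, add_comm,
      hηp.intervalIntegral_add_eq (1 / 2) 0, zero_add, hη0])
  obtain ⟨χ, hχp, hχs, hχ1, hχ0⟩ := exists_cutoff
  obtain ⟨χ₁, hχ₁, he₁⟩ := exists_circle_of_periodic hχp hχs
  obtain ⟨χ₂, hχ₂, he₂⟩ := exists_circle_of_periodic (f := fun y => χ (y + 1 / 2))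
    (hχp.add_const _) (by fun_prop)
  -- Write `h = (h - c) + c`: the first term is `H₀'`, and on the strip `c = c χ(a) η(y) + c χ(a +
  -- 1/2) η(y + 1/2)`.
  refine ⟨![fun _ => 1, fun a => c * χ₁ a, fun a => c * χ₂ a], ![H₀, H₁, H₂], ?_, ?_, ?_⟩
  · intro k
    fin_cases k
    · exact contDiff_const
    · exact contDiff_const.mul hχ₁
    · exact contDiff_const.mul hχ₂
  · intro k
    fin_cases k
    · exact hH₀
    · exact hH₁
    · exact hH₂
  · intro a r hr
    obtain ⟨a, ha, rfl⟩ : ∃ b ∈ Set.Ico (-1 / 16 : ℝ) (15 / 16), (b : UnitAddCircle) = a := by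
      have := (AddCircle.coe_image_Ico_eq (p := (1 : ℝ)) (-1 / 16 : ℝ)).symm ▸ Set.mem_univ a
      obtain ⟨b, hb, e⟩ := this
      exact ⟨b, ⟨hb.1, by linarith [hb.2]⟩, e⟩
    -- If the cut-off is active, then `a ≤ 9/16` and `a + r` stays in `[-1/16, 13/16]`, where `η =
    -- 1`. The next identity is the same shifted by `1/2`, with a full period subtracted when `a ≥
    -- 7/16`.
    have k₁ : χ a * η (a + r) = χ a := by
      rcases le_or_gt a (9 / 16) with h | h
      · rw [hη1 _ ⟨by linarith [ha.1, hr.1], by linarith [hr.2]⟩, mul_one]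
      · rw [hχ0 a ⟨h, ha.2⟩, zero_mul]
    have k₂ : χ (a + 1 / 2) * η (a + r + 1 / 2) = χ (a + 1 / 2) := by
      rcases le_or_gt a (1 / 16) with h | h
      · rw [hη1 _ ⟨by linarith [ha.1, hr.1], by linarith [hr.2]⟩, mul_one]
      rcases lt_or_ge a (7 / 16) with h' | h'
      · rw [hχ0 _ ⟨by linarith, by linarith⟩, zero_mul]
      · rw [← hηp.sub_eq, hη1 _ ⟨by linarith [hr.1], by linarith [ha.2, hr.2]⟩, mul_one]
    have key : χ a * η (a + r) + χ (a + 1 / 2) * η (a + r + 1 / 2) = 1 := by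
      rw [k₁, k₂, hχ1]
    have e : (a : UnitAddCircle) + (r : UnitAddCircle) = ((a + r : ℝ) : UnitAddCircle) := rfl
    simp only [e, Fin.sum_univ_three, Matrix.cons_val_zero, Matrix.cons_val_one,
      Matrix.cons_val, hd₀, hd₁, hd₂, he₁, he₂]
    linear_combination (-c) * key

end Circle

/-! ### Characteristics and transport of labels -/

section Transport

variable {ι : Type} [Fintype ι] {T : ℝ} {u : ℝ → Torus ι → ι → ℝ}

/-- The characteristic of a smooth bounded flow through `(t, y)`, on the universal cover. -/
theorem exists_characteristic (hu : IsFlow T u) {L : ℝ}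
    (hL : ∀ t ∈ Set.Icc 0 T, ∀ x j, |u t x j| ≤ L) {t : ℝ} (ht : t ∈ Set.Icc 0 T) (y : ι → ℝ) :
    ∃ X : ℝ → ι → ℝ, X t = y ∧
      ∀ τ ∈ Set.Icc 0 T, HasDerivWithinAt X (u τ (proj (X τ))) (Set.Icc 0 T) τ := by
  have hT : 0 ≤ T := ht.1.trans ht.2
  have hV : ContDiffOn ℝ ∞ (fun q : ℝ × (ι → ℝ) => u q.1 (proj q.2)) (Set.Icc 0 T ×ˢ Set.univ) :=
    contDiffOn_pi.mpr fun i => hu i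
  let L' : NNReal := ⟨|L|, abs_nonneg L⟩
  let T' : NNReal := ⟨T, hT⟩
  have hcv : Convex ℝ (Set.Icc 0 T ×ˢ Metric.closedBall y (L' * T' : NNReal)) :=
    (convex_Icc 0 T).prod (convex_closedBall _ _)
  obtain ⟨K, hK⟩ := (hV.mono (Set.prod_mono_right (Set.subset_univ
    (Metric.closedBall y (L' * T' : NNReal))))).exists_lipschitzOnWith (by simp) hcv
      (isCompact_Icc.prod (isCompact_closedBall _ _))
  -- A ball of radius speed times `T` cannot be left during `[0, T]`, so the solution exists on the
  -- whole interval.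
  have hPL : IsPicardLindelof (fun τ z => u τ (proj z)) (tmin := 0) (tmax := T) ⟨t, ht⟩ y
      (L' * T') 0 L' K := by
    refine ⟨fun τ hτ => ?_, fun z _ => ?_, fun τ hτ z _ => ?_, ?_⟩
    · intro z hz z' hz'
      have := hK (x := (τ, z)) ⟨hτ, hz⟩ (y := (τ, z')) ⟨hτ, hz'⟩
      simpa [Prod.edist_eq] using this
    · exact hV.continuousOn.comp (f := fun τ : ℝ => (τ, z)) (by fun_prop) fun τ hτ => ⟨hτ, trivial⟩
    · refine (pi_norm_le_iff_of_nonneg (abs_nonneg L)).mpr fun j => ?_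
      exact (hL τ hτ _ j).trans (le_abs_self L)
    · have : max (T - t) (t - 0) ≤ T := max_le (by linarith [ht.1]) (by linarith [ht.2])
      simp only [NNReal.coe_mul, NNReal.coe_zero, sub_zero] at this ⊢
      exact mul_le_mul_of_nonneg_left this (abs_nonneg L)
  exact hPL.exists_eq_forall_mem_Icc_hasDerivWithinAt₀

/-- Bounds on the displacement along a curve. -/
theorem displacement_mem_Icc {X : ℝ → ℝ} {X' : ℝ → ℝ} {c₁ c₂ : ℝ}
    (hX : ∀ τ ∈ Set.Icc 0 T, HasDerivWithinAt X (X' τ) (Set.Icc 0 T) τ)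
    (h1 : ∀ τ ∈ Set.Icc 0 T, c₁ ≤ X' τ) (h2 : ∀ τ ∈ Set.Icc 0 T, X' τ ≤ c₂)
    {t : ℝ} (ht : t ∈ Set.Icc 0 T) : X t - X 0 ∈ Set.Icc (c₁ * t) (c₂ * t) := by
  have hc : ContinuousOn X (Set.Icc 0 T) := fun τ hτ => (hX τ hτ).continuousWithinAt
  have hd : ∀ τ ∈ interior (Set.Icc 0 T), HasDerivAt X (X' τ) τ := fun τ hτ =>
    (hX τ (interior_subset hτ)).hasDerivAt (mem_interior_iff_mem_nhds.mp hτ)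
  have hdf : DifferentiableOn ℝ X (interior (Set.Icc 0 T)) := fun τ hτ =>
    (hd τ hτ).differentiableAt.differentiableWithinAt
  have h0 : (0 : ℝ) ∈ Set.Icc 0 T := ⟨le_rfl, ht.1.trans ht.2⟩
  have l := (convex_Icc 0 T).mul_sub_le_image_sub_of_le_deriv hc hdf (C := c₁)
    (fun τ hτ => by rw [(hd τ hτ).deriv]; exact h1 τ (interior_subset hτ)) 0 h0 t ht ht.1
  have r := (convex_Icc 0 T).image_sub_le_mul_sub_of_deriv_le hc hdf (C := c₂)
    (fun τ hτ => by rw [(hd τ hτ).deriv]; exact h2 τ (interior_subset hτ)) 0 h0 t ht ht.1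
  rw [sub_zero] at l r
  exact ⟨l, r⟩

variable [DecidableEq ι]

/-- The space-time derivative in the direction `(1, v)` in terms of partial derivatives. -/
theorem fderiv_one_prod_eq (hT : 0 < T) {F : ℝ × (ι → ℝ) → ℝ} {D : ℝ × (ι → ℝ) →L[ℝ] ℝ}
    {t : ℝ} (ht : t ∈ Set.Icc 0 T) {y : ι → ℝ}
    (h : HasFDerivWithinAt F D (Set.Icc 0 T ×ˢ Set.univ) (t, y)) (v : ι → ℝ) :
    D (1, v) = derivWithin (fun τ => F (τ, y)) (Set.Icc 0 T) t
      + ∑ j, v j * deriv (fun s : ℝ => F (t, y + Pi.single j s)) 0 := by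
  have h1 : HasDerivWithinAt (fun τ => F (τ, y)) (D (1, 0)) (Set.Icc 0 T) t :=
    HasFDerivWithinAt.comp_hasDerivWithinAt (f := fun τ : ℝ => (τ, y)) t h
      ((hasDerivWithinAt_id t _).prodMk (hasDerivWithinAt_const t _ y)) fun τ hτ => ⟨hτ, trivial⟩
  have h2 : ∀ j, HasDerivAt (fun s : ℝ => F (t, y + Pi.single j s)) (D (0, Pi.single j 1)) 0 := by
    intro j
    have hs : HasDerivWithinAt (fun s : ℝ => y + Pi.single j s) (Pi.single j (1 : ℝ))
        Set.univ 0 := (HasDerivAt.const_add y (hasDerivAt_single j (0 : ℝ))).hasDerivWithinAt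
    rw [← hasDerivWithinAt_univ]
    have h' : HasFDerivWithinAt F D (Set.Icc 0 T ×ˢ Set.univ) (t, y + Pi.single j (0 : ℝ)) := by
      simpa using h
    have hc : HasDerivWithinAt (fun s : ℝ => (t, y + Pi.single j s))
        ((0 : ℝ), (Pi.single j 1 : ι → ℝ)) Set.univ 0 := (hasDerivWithinAt_const _ _ t).prodMk hs
    have hm : Set.MapsTo (fun s : ℝ => (t, y + Pi.single j s)) Set.univ
        (Set.Icc 0 T ×ˢ Set.univ) := fun s _ => ⟨ht, trivial⟩
    exact HasFDerivWithinAt.comp_hasDerivWithinAt (l := F) 0 h' hc hm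
  rw [h1.derivWithin (uniqueDiffOn_Icc hT t ht)]
  simp only [fun j => (h2 j).deriv]
  have e : ((1 : ℝ), v) = (1, 0) + ∑ j, v j • ((0 : ℝ), (Pi.single j 1 : ι → ℝ)) := by
    ext i
    · simp [Prod.fst_sum]
    · simp [Prod.snd_sum, Finset.sum_apply, Pi.single_apply]
  rw [e, map_add, map_sum]
  simp only [map_smul, smul_eq_mul]

/-- A lift `B` of the labels map has vanishing derivative along the flow. -/
theorem fderivWithin_lift_eq_zero (hT : 0 < T) {B : ℝ → (ι → ℝ) → ι → ℝ}
    (hB : ContDiffOn ℝ ∞ (fun q : ℝ × (ι → ℝ) => B q.1 q.2) (Set.Icc 0 T ×ˢ Set.univ))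
    (htr : ∀ t ∈ Set.Icc 0 T, ∀ y, ∀ i, dt T (fun τ z => B τ z i) t y
        + ∑ j, u t (proj y) j * deriv (fun s : ℝ => B t (y + Pi.single j s) i) 0 = 0)
    {t : ℝ} (ht : t ∈ Set.Icc 0 T) (y : ι → ℝ) :
    ∃ D : ℝ × (ι → ℝ) →L[ℝ] (ι → ℝ),
      HasFDerivWithinAt (fun q : ℝ × (ι → ℝ) => B q.1 q.2) D (Set.Icc 0 T ×ˢ Set.univ) (t, y) ∧
      D (1, u t (proj y)) = 0 := by
  have h := ((hB.differentiableOn (by simp)) (t, y) ⟨ht, trivial⟩).hasFDerivWithinAt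
  refine ⟨_, h, funext fun i => ?_⟩
  have hi := fderiv_one_prod_eq hT ht (hasFDerivWithinAt_pi'.mp h i) (u t (proj y))
  exact hi.trans (htr t ht y i)

variable {A : ℝ → Torus ι → Torus ι}

/-- Functions of the labels are smooth. -/
theorem IsLabelsMap.spacetimeSmooth (hA : IsLabelsMap T u A) {φ : Torus ι → ℝ}
    (hφ : Smooth φ) : SpacetimeSmooth T fun t x => φ (A t x) := by
  obtain ⟨⟨B, hB, hBA⟩, -⟩ := hA
  refine (ContDiff.comp_contDiffOn (g := fun y : ι → ℝ => φ (proj y)) hφ hB).congr fun q hq => ?_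
  simp [(hBA q.1 hq.1 q.2).1]

/-- Functions of the labels are transported by the flow. -/
theorem IsLabelsMap.transport (hT : 0 < T) (hA : IsLabelsMap T u A) {φ : Torus ι → ℝ}
    (hφ : Smooth φ) {t : ℝ} (ht : t ∈ Set.Icc 0 T) (x : Torus ι) :
    dt T (fun t x => φ (A t x)) t x + ∑ j, u t x j * pd j (fun x => φ (A t x)) x = 0 := by
  obtain ⟨⟨B, hB, hBA⟩, -⟩ := hA
  obtain ⟨y, rfl⟩ := proj_surjective x
  obtain ⟨D, hD, hD0⟩ := fderivWithin_lift_eq_zero hT hB (fun t ht y => (hBA t ht y).2) ht y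
  have hφd := (ContDiff.differentiable hφ (by simp) (B t y)).hasFDerivAt
  have h1 := (hφd.comp_hasFDerivWithinAt (t, y) hD).congr
    (f₁ := fun q : ℝ × (ι → ℝ) => φ (A q.1 (proj q.2)))
    (fun q hq => by simp [(hBA q.1 hq.1 q.2).1]) (by simp [(hBA t ht y).1])
  have h2 := fderiv_one_prod_eq hT ht h1 (u t (proj y))
  rw [ContinuousLinearMap.comp_apply, hD0, map_zero] at h2
  rw [h2]
  simp only [dt, pd, proj_add]

/-- The displacement `x - A(t,x)` of a particle has a lift bounded by the velocity. -/
theorem IsLabelsMap.exists_displacement (hT : 0 < T) (hu : IsFlow T u) (hA : IsLabelsMap T u A)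
    {c₁ c₂ : ℝ} (hU : ∀ t ∈ Set.Icc 0 T, ∀ x j, c₁ ≤ u t x j ∧ u t x j ≤ c₂)
    {t : ℝ} (ht : t ∈ Set.Icc 0 T) (x : Torus ι) (i : ι) :
    ∃ r ∈ Set.Icc (c₁ * t) (c₂ * t), x i = A t x i + (r : UnitAddCircle) := by
  obtain ⟨⟨B, hB, hBA⟩, hA0⟩ := hA
  obtain ⟨y, rfl⟩ := proj_surjective x
  obtain ⟨X, hXt, hX⟩ := exists_characteristic hu (L := max |c₁| |c₂|)
    (fun t ht x j => abs_le_max_abs_abs (hU t ht x j).1 (hU t ht x j).2) ht y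
  have h0 : (0 : ℝ) ∈ Set.Icc 0 T := ⟨le_rfl, hT.le⟩
  -- The lift is constant along characteristics, since its derivative in the direction `(1, u)`
  -- vanishes.
  have hBX : ∀ τ ∈ Set.Icc 0 T, HasDerivWithinAt (fun τ => B τ (X τ)) 0 (Set.Icc 0 T) τ := by
    intro τ hτ
    obtain ⟨D, hD, hD0⟩ :=
      fderivWithin_lift_eq_zero hT hB (fun t ht y => (hBA t ht y).2) hτ (X τ)
    rw [← hD0]
    exact HasFDerivWithinAt.comp_hasDerivWithinAt (f := fun τ : ℝ => (τ, X τ)) τ hD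
      ((hasDerivWithinAt_id τ _).prodMk (hX τ hτ)) fun τ hτ => ⟨hτ, trivial⟩
  have hconst : B t (X t) = B 0 (X 0) :=
    constant_of_derivWithin_zero (fun τ hτ => (hBX τ hτ).differentiableWithinAt)
      (fun τ hτ => (hBX τ ⟨hτ.1, hτ.2.le⟩).derivWithin
        (uniqueDiffOn_Icc hT τ ⟨hτ.1, hτ.2.le⟩)) t ht
  -- The lift at time 0 need not be the identity, only project to it, so labels and starting points
  -- are compared on the torus.
  have hAt : A t (proj y) = proj (X 0) := by
    rw [← (hBA t ht y).1, ← hXt, hconst, (hBA 0 h0 _).1, hA0]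
  refine ⟨X t i - X 0 i, displacement_mem_Icc (X := fun τ => X τ i)
    (fun τ hτ => hasDerivWithinAt_pi.mp (hX τ hτ) i) (fun τ hτ => (hU τ hτ _ i).1)
    (fun τ hτ => (hU τ hτ _ i).2) ht, ?_⟩
  rw [hAt, hXt]
  simp [proj]

end Transport

/-! ### Absorbing a force built from labels -/

section Extendible

variable {ι : Type} [Fintype ι] [DecidableEq ι] (g : Metric ι)

/-- A force of the form `∑ σ, φ_σ(A(t,x)) ∂_i v_σ(x)` can be absorbed by an extension. -/
theorem isExtendible_of_force {T : ℝ} (hT : 0 < T) {u : ℝ → Torus ι → ι → ℝ}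
    (hu : IsIncompressibleFlow g T u) {A : ℝ → Torus ι → Torus ι} (hA : IsLabelsMap T u A)
    {S : Type} [Fintype S] {φ v : S → Torus ι → ℝ} (hφ : ∀ σ, Smooth (φ σ))
    (hv : ∀ σ, Smooth (v σ)) {p : ℝ → Torus ι → ℝ} (hp : SpacetimeSmooth T p)
    (heq : ∀ t ∈ Set.Icc 0 T, ∀ x i, dt T (fun τ z => lower g (u τ) z i) t x
      + accForm g (u t) x i + ∑ σ, φ σ (A t x) * pd i (v σ) x = -pd i (p t) x) :
    IsExtendible g T u := by
  choose C hC using fun σ => (hφ σ).exists_add_const_pos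
  choose C' hC' using fun σ => (hv σ).exists_add_const_pos
  have hvC : ∀ σ, Smooth fun x => v σ x + C' σ := fun σ => (hv σ).add (Smooth.const _)
  -- The index `none` is the swirl-free fibre that normalizes the product of the weights. In `β`,
  -- strict positivity under the root keeps it smooth.
  let W : Option S → Torus ι → ℝ := fun o x =>
    o.elim (∏ σ, (v σ x + C' σ)) fun σ => (v σ x + C' σ)⁻¹
  let β : Option S → Torus ι → ℝ := fun o a =>
    o.elim 0 fun σ => Real.sqrt (2 * (φ σ a + C σ))
  have hW : ∀ o, Smooth (W o) := by
    rintro (_ | σ)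
    · exact Smooth.prod hvC
    · exact (hvC σ).inv fun x => (hC' σ x).ne'
  have hβ : ∀ o, Smooth (β o) := by
    rintro (_ | σ)
    · exact Smooth.const 0
    · exact ((Smooth.const 2).mul ((hφ σ).add (Smooth.const _))).sqrt fun x =>
        (mul_pos two_pos (hC σ x)).ne'
  have hWpos : ∀ o x, 0 < W o x := by
    rintro (_ | σ) x
    · exact Finset.prod_pos fun σ _ => hC' σ x
    · exact inv_pos.mpr (hC' σ x)
  let e := (Fintype.equivFin (Option S)).symm
  refine isExtendible_of_transported g hT hu (w := fun s => W (e s)) (fun s => hW _)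
    (fun s x => hWpos _ x) (fun x => ?_) (b := fun s t x => β (e s) (A t x))
    (fun s => hA.spacetimeSmooth (hβ _)) (fun t ht x s => hA.transport hT (hβ _) ht x)
    -- The shift `C σ` of `φ σ` adds the gradient of `∑ C σ * v σ` to the force, which the new
    -- pressure compensates.
    (p := fun t x => p t x + ∑ σ, -C σ * v σ x)
    (hp.add (Smooth.spacetime (Smooth.sum fun σ => (Smooth.const _).mul (hv σ)) T))
    fun t ht x i => ?_
  · rw [e.prod_comp (fun o => W o x), Fintype.prod_option]
    change (∏ σ, (v σ x + C' σ)) * ∏ σ, (v σ x + C' σ)⁻¹ = 1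
    rw [← Finset.prod_mul_distrib]
    exact Finset.prod_eq_one fun σ _ => mul_inv_cancel₀ (hC' σ x).ne'
  · rw [e.sum_comp (fun o => β o (A t x) ^ 2 * pd i (fun z => (W o z)⁻¹) x), Fintype.sum_option]
    have h1 : ∀ σ, β (some σ) (A t x) ^ 2 = 2 * (φ σ (A t x) + C σ) := fun σ =>
      Real.sq_sqrt (mul_pos two_pos (hC σ _)).le
    have h2 : ∀ σ, pd i (fun z => (W (some σ) z)⁻¹) x = pd i (v σ) x := by
      intro σ
      simp only [W, Option.elim_some, inv_inv]
      rw [pd_add (hv σ) (Smooth.const _), pd_const, add_zero]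
    have h3 : pd i (fun x => p t x + ∑ σ, -C σ * v σ x) x =
        pd i (p t) x + ∑ σ, -C σ * pd i (v σ) x := by
      rw [pd_add (hp.smooth ht) (Smooth.sum fun σ => (Smooth.const _).mul (hv σ)),
        pd_sum fun σ => (Smooth.const _).mul (hv σ)]
      congr 1
      refine Finset.sum_congr rfl fun σ _ => ?_
      rw [pd_mul (Smooth.const _) (hv σ), pd_const, zero_mul, zero_add]
    have h4 : (1 / 2 : ℝ) * ∑ σ, 2 * (φ σ (A t x) + C σ) * pd i (v σ) x =
        ∑ σ, φ σ (A t x) * pd i (v σ) x - ∑ σ, -C σ * pd i (v σ) x := by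
      rw [Finset.mul_sum, ← Finset.sum_sub_distrib]
      exact Finset.sum_congr rfl fun σ _ => by ring
    have h5 : β none (A t x) = 0 := rfl
    simp only [h1, h2, h3, h5]
    rw [zero_pow two_ne_zero, zero_mul, zero_add, h4]
    linear_combination heq t ht x i

end Extendible

end EulerExt

end

/-! ### The given force in absorbable form -/

theorem corollary4p1 (d : ℕ) (T : ℝ) (hT : 0 < T)
    (g : EulerExt.Metric (Fin d))
    (u : ℝ → EulerExt.Torus (Fin d) → Fin d → ℝ)
    (hu : EulerExt.IsIncompressibleFlow g T u)
    (hU : ∀ t ∈ Set.Icc 0 T, ∀ x j, 1 / (8 * T) < u t x j ∧ u t x j < 1 / (4 * T))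
    (A : ℝ → EulerExt.Torus (Fin d) → EulerExt.Torus (Fin d))
    (hA : EulerExt.IsLabelsMap T u A)
    (F : Fin d → EulerExt.Torus (Fin d) → UnitAddCircle → ℝ)
    (m : Fin d → ℕ)
    (f : (i : Fin d) → Fin (m i) → EulerExt.Torus (Fin d) → ℝ)
    (h : (i : Fin d) → Fin (m i) → UnitAddCircle → ℝ)
    (hf : ∀ i s, EulerExt.Smooth (f i s))
    (hh : ∀ i s, EulerExt.CircleSmooth (h i s))
    (hF : ∀ i a y, F i a y = ∑ s, f i s a * h i s y)
    (p : ℝ → EulerExt.Torus (Fin d) → ℝ)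
    (hp : EulerExt.SpacetimeSmooth T p)
    (heq : ∀ t ∈ Set.Icc 0 T, ∀ x i,
      EulerExt.dt T (fun τ z => EulerExt.lower g (u τ) z i) t x
        + ∑ j, u t x j * EulerExt.covDerivForm g (EulerExt.lower g (u t)) j i x
        + F i (A t x) (x i) = - EulerExt.pd i (p t) x) :
    EulerExt.IsExtendible g T u := by
  choose χ H hχ hH hsum using fun i s => EulerExt.exists_eq_sum_circleDeriv (hh i s)
  -- The index is a coordinate `i`, a summand of `F i` and one of the three strip terms; the cut-off
  -- in `a i` joins the label factor.
  refine EulerExt.isExtendible_of_force g hT hu hA (S := Σ i, Fin (m i) × Fin 3)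
    (φ := fun σ a => f σ.1 σ.2.1 a * χ σ.1 σ.2.1 σ.2.2 (a σ.1))
    (v := fun σ x => H σ.1 σ.2.1 σ.2.2 (x σ.1))
    (fun σ => (hf _ _).mul ((hχ _ _ _).comp_eval _)) (fun σ => (hH _ _ _).comp_eval _) hp
    fun t ht x i => ?_
  rw [← heq t ht x i, EulerExt.sum_mul_covDerivForm_lower, hF]
  congr 1
  obtain ⟨r, hr, hx⟩ := hA.exists_displacement hT hu.1
    (fun t ht x j => ⟨(hU t ht x j).1.le, (hU t ht x j).2.le⟩) ht x i
  have hr' : r ∈ Set.Icc (0 : ℝ) (1 / 4) := by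
    refine ⟨le_trans (mul_nonneg (by positivity) ht.1) hr.1, hr.2.trans ?_⟩
    -- The speed bound over a time at most `T` gives displacement at most `1/4`, the width of the
    -- strip.
    calc 1 / (4 * T) * t ≤ 1 / (4 * T) * T := mul_le_mul_of_nonneg_left ht.2 (by positivity)
      _ = 1 / 4 := by field_simp
  simp only [EulerExt.pd_comp_eval]
  -- Each potential depends on a single coordinate, so only the block of `i` contributes to the
  -- `i`-th component.
  rw [Fintype.sum_sigma, Finset.sum_eq_single i]
  · simp only [if_true]
    rw [Fintype.sum_prod_type]
    refine Finset.sum_congr rfl fun s _ => ?_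
    have := hsum i s (A t x i) r hr'
    rw [← hx] at this
    rw [this, Finset.mul_sum]
    exact Finset.sum_congr rfl fun k _ => mul_assoc _ _ _
  · intro j _ hj
    exact Finset.sum_eq_zero fun k _ => by rw [if_neg (Ne.symm hj), mul_zero]
  · exact fun hi => absurd (Finset.mem_univ i) hi
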